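/- Identify the $(n+1)$-th finite binary string in length-lexicographic order with $n$, so that an oracle (a language $X\subseteq\{0,1\}^*$) is an infinite binary sequence $X\in\{0,1\}^\omega$, its characteristic sequence. An oracle Turing machine writes strings on a query tape, and asking the oracle about the string written there takes one step. A machine (with or without oracle) \emph{decides a language $L$ in time} $f:\{0,1\}^*\to\mathbb N$ if on every input $x$ it halts within $f(x)$ steps and accepts exactly when $x\in L$. An oracle $X$ is \emph{low for speed} if for every computable language $L\subseteq\{0,1\}^*$, every function $f:\{0,1\}^*\to\mathbb N$ and every oracle machine that decides $L$ in time $f$ with oracle $X$, there are a machine without oracle and a polynomial $p$ such that this machine decides $L$ in time $p\circ f$. Let $\mathsf{LFS}\subseteq\{0,1\}^\omega$ be the set of low for speed oracles, and let $\lambda$ be the Lebesgue (uniform) measure on $\{0,1\}^\omega$. A \emph{Schnorr test} is a uniformly effectively open sequence $(U_n)_{n\in\mathbb N}$ of subsets of $\{0,1\}^\omega$ with $\lambda(U_n)\le 2^{-n}$ for all $n$ such that the reals $\lambda(U_n)$ are uniformly computable; $X$ is \emph{Schnorr random} if $X\notin\bigcap_n U_n$ for every Schnorr test. \textbf{Theorem.}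 The set $\mathsf{LFS}$ has measure zero, $\lambda(\mathsf{LFS})=0$. Indeed, no Schnorr random $X\in\{0,1\}^\omega$ is low for speed. -/

import Mathlib

namespace LowForSpeed

/-! ### Oracle Turing machines and their running time -/

/-- A tape symbol: `none` is the blank, `some (Sum.inl b)` is the bit `b`, and
`some (Sum.inr s)` is an additional work symbol. -/
abbrev Symbol (S : Type) : Type := Option (Bool ⊕ S)

/-- Movement of a head. -/
inductive Move : Type
  | left
  | stay
  | right

/-- A two-way infinite tape with finitely many visited cells: `right` lists the scanned cell and
the cells to its right, `left` lists the cells to the left of the head, nearest cell first. All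
cells that are not listed are blank. -/
structure Tape (S : Type) : Type where
  left : List (Symbol S)
  right : List (Symbol S)

/-- The scanned symbol. -/
def Tape.read {S : Type} (t : Tape S) : Symbol S := t.right.headD none

/-- Overwrite the scanned symbol. -/
def Tape.write {S : Type} (a : Symbol S) (t : Tape S) : Tape S := ⟨t.left, a :: t.right.tail⟩

/-- Move the head by at most one cell. -/
def Tape.move {S : Type} : Move → Tape S → Tape S
  | .left, t => ⟨t.left.tail, t.left.headD none :: t.right⟩
  | .stay, t => t
  | .right, t => ⟨t.right.headD none :: t.left, t.right.tail⟩

/-- What a machine with `k + 1` work tapes does in one step. -/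
inductive Action (Q S : Type) (k : ℕ) : Type
  /-- halt with the given answer (`true`: accept, `false`: reject) -/
  | halt (answer : Bool) : Action Q S k
  /-- go to state `q`, write on every work tape and move its head, and possibly write one more
  bit at the end of the query tape -/
  | act (q : Q) (w : Fin (k + 1) → Symbol S × Move) (append : Option Bool) : Action Q S k
  /-- ask the oracle about the string on the query tape, erase the query tape, and go to the
  state `yes` or `no` according to the answer -/
  | query (yes no : Q) : Action Q S k

/-- A deterministic multitape oracle Turing machine: finitely many states, a finite tape alphabet,
`k + 1` work tapes (the first one also being the input tape), and a query tape. -/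
structure OracleTM : Type 1 where
  /-- states -/
  Q : Type
  [finQ : Fintype Q]
  /-- work symbols besides the blank and the two bits -/
  S : Type
  [finS : Fintype S]
  /-- number of work tapes besides the input tape -/
  k : ℕ
  /-- initial state -/
  start : Q
  /-- transition function: state and scanned symbols determine the action -/
  trans : Q → (Fin (k + 1) → Symbol S) → Action Q S k

namespace OracleTM

/-- A configuration: state, work tapes, and the string on the query tape. -/
structure Cfg (M : OracleTM) : Type where
  state : M.Q
  tapes : Fin (M.k + 1) → Tape M.S
  query : List Bool

/-- The initial configuration: the input stands on tape `0`, with the head on its first symbol;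
everything else is blank. -/
def init (M : OracleTM) (x : List Bool) : M.Cfg where
  state := M.start
  tapes := fun i => if i = 0 then ⟨[], x.map fun b => some (Sum.inl b)⟩ else ⟨[], []⟩
  query := []

/-- One step with the oracle `O`: either the machine halts with an answer, or it reaches a new
configuration. -/
def step (M : OracleTM) (O : List Bool → Bool) (c : M.Cfg) : Bool ⊕ M.Cfg :=
  match M.trans c.state (fun i => (c.tapes i).read) with
  | .halt b => Sum.inl b
  | .act q w a =>
      Sum.inr ⟨q, fun i => ((c.tapes i).write (w i).1).move (w i).2, c.query ++ a.toList⟩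
  | .query yes no => Sum.inr ⟨if O c.query then yes else no, c.tapes, []⟩

/-- The answer of the machine started in the configuration `c`, if it halts within `t` steps. -/
def run (M : OracleTM) (O : List Bool → Bool) : ℕ → M.Cfg → Option Bool
  | 0, _ => none
  | t + 1, c =>
      match M.step O c with
      | Sum.inl b => some b
      | Sum.inr c' => M.run O t c'

/-- `M` with oracle `O` decides the language `L` in time `f`: on every input `x` it halts within
`f x` steps, and it accepts if and only if `x ∈ L`. -/
def DecidesInTime (M : OracleTM) (O : List Bool → Bool) (L : Set (List Bool))
    (f : List Bool → ℕ) : Prop :=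
  ∀ x : List Bool, ∃ b : Bool, M.run O (f x) (M.init x) = some b ∧ (b = true ↔ x ∈ L)

/-- `M` is a machine without oracle: it has no query instruction. -/
def OracleFree (M : OracleTM) : Prop :=
  ∀ q a yes no, M.trans q a ≠ .query yes no

end OracleTM

/-! ### Oracles as infinite binary sequences; lowness for speed -/

/-- The position of a string in the length-lexicographic order of all binary strings, starting
from `0` for the empty string. -/
def strIndex (x : List Bool) : ℕ := x.foldl (fun n b => 2 * n + 1 + b.toNat) 0

/-- The language whose characteristic sequence is `A`. -/
def toOracle (A : ℕ → Bool) (x : List Bool) : Bool := A (strIndex x)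

/-- `A` is low for speed: whenever a computable language is decided in time `f` by a machine with
oracle `A`, it is decided in time `p ∘ f`, for some polynomial `p`, by a machine without oracle. -/
def IsLowForSpeed (A : ℕ → Bool) : Prop :=
  ∀ L : Set (List Bool), ComputablePred (fun x => x ∈ L) →
    ∀ (M : OracleTM) (f : List Bool → ℕ), M.DecidesInTime (toOracle A) L f →
      ∃ (M' : OracleTM) (p : Polynomial ℕ), M'.OracleFree ∧
        M'.DecidesInTime (fun _ => false) L (fun x => p.eval (f x))

/-- The class of low for speed oracles. -/
def LFS : Set (ℕ → Bool) := {A | IsLowForSpeed A}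

/-! ### Lebesgue measure on Cantor space and Schnorr randomness -/

/-- Lebesgue (uniform) measure on infinite binary sequences: the bits are independent and fair. -/
noncomputable def lebesgue : MeasureTheory.Measure (ℕ → Bool) :=
  MeasureTheory.Measure.infinitePi fun _ : ℕ => (PMF.uniformOfFintype Bool).toMeasure

/-- The sequences extending the finite string `σ`. -/
def cylinder (σ : List Bool) : Set (ℕ → Bool) :=
  {A | ∀ (i : ℕ) (h : i < σ.length), A i = σ[i]}

/-- A sequence of uniformly effectively open sets: there is a c.e. set `W` of pairs such that
`U n` is the union of the cylinders `[σ]` with `(n, σ) ∈ W`. -/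
def UniformlyEffectivelyOpen (U : ℕ → Set (ℕ → Bool)) : Prop :=
  ∃ W : Set (ℕ × List Bool), REPred (fun p => p ∈ W) ∧
    ∀ n, U n = ⋃ σ ∈ {σ : List Bool | (n, σ) ∈ W}, cylinder σ

/-- A uniformly computable sequence of nonnegative reals: dyadic rational approximations are
computable to any prescribed precision. -/
def UniformlyComputable (r : ℕ → ℝ) : Prop :=
  ∃ g : ℕ × ℕ → ℕ, Computable g ∧ ∀ n k, |r n - (g (n, k) : ℝ) / 2 ^ k| ≤ 1 / 2 ^ k

/-- A Schnorr test: uniformly effectively open sets `U n` with `λ(U n) ≤ 2⁻ⁿ` whose measures are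
uniformly computable. -/
structure IsSchnorrTest (U : ℕ → Set (ℕ → Bool)) : Prop where
  effectivelyOpen : UniformlyEffectivelyOpen U
  measure_le : ∀ n, lebesgue (U n) ≤ (1 / 2) ^ n
  computable_measure : UniformlyComputable fun n => (lebesgue (U n)).toReal

/-- `A` is Schnorr random if it passes every Schnorr test. -/
def IsSchnorrRandom (A : ℕ → Bool) : Prop :=
  ∀ U : ℕ → Set (ℕ → Bool), IsSchnorrTest U → A ∉ ⋂ n, U n

end LowForSpeed

/-! The proof builds one Schnorr test that contains every low for speed oracle. There is a
computable sequence of strings `target n`, of length `n`, that agrees infinitely often with each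
primitive recursive sequence `F` with `|F n| = n`. Since the cylinder of `target n` has measure
`2⁻ⁿ`, the sets of sequences extending some `target n` with `n > k` form a Schnorr test
(`isSchnorrTest_prefixTail`).

Suppose that `A` avoids the `k`-th set. Consider the computable language of all codes of `target n`
with `n > k`, where the code of a string lists the oracle queries and answers that would confirm it
as a prefix of the oracle. A machine with oracle `A` checks these claims directly. If all are true,
then the input is not in the language and is rejected in linear time; otherwise a slow decider is
run (`exists_fast_machine`).

Were `A` low for speed, an oracle-free machine `M'` would decide the same language and reject the
codes of the prefixes of `A` in polynomial time. Hence for all large `n` some string of length `n`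
has a code that `M'` rejects within a fixed superpolynomial bound. An oracle-free run is primitive
recursive in time and input (`primrec_run`), so a bounded search for such a string gives a primitive
recursive sequence `rejected M'`. At some large `n` it equals `target n`, and there `M'` rejects a
member of the language (`not_isLowForSpeed`).

The sequence `target` comes from running coded programs with Ackermann fuel, which eventually
exceeds every primitive recursive fuel bound (`frequently_anticipate_eq`). -/

namespace LowForSpeed

/-! ### Strings in length-lexicographic order -/

/-- The successor in length-lexicographic order, for strings written in reverse. -/
def incr : List Bool → List Bool
  | [] => [false]
  | false :: l => true :: l
  | true :: l => false :: incr l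

/-- The position of the reversed string in the length-lexicographic order. -/
def revIndex (l : List Bool) : ℕ := l.foldr (fun b n => 2 * n + 1 + b.toNat) 0

theorem strIndex_reverse (l : List Bool) : strIndex l.reverse = revIndex l := by
  simp [strIndex, revIndex, List.foldl_reverse]

theorem revIndex_incr (l : List Bool) : revIndex (incr l) = revIndex l + 1 := by
  induction l with
  | nil => rfl
  | cons b l ih =>
    cases b
    · simp [incr, revIndex]
    · simp only [incr, revIndex, List.foldr_cons, Bool.toNat_false, Bool.toNat_true] at ih ⊢
      omega

/-- The `n`-th string in length-lexicographic order. -/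
def natStr (n : ℕ) : List Bool := (incr^[n] []).reverse

theorem strIndex_natStr (n : ℕ) : strIndex (natStr n) = n := by
  rw [natStr, strIndex_reverse]
  induction n with
  | zero => rfl
  | succ n ih => rw [Function.iterate_succ_apply', revIndex_incr, ih]

/-- This is bijective base two: the parity of a nonzero value determines the outermost digit, and
the remaining digits follow by induction. -/
theorem revIndex_injective : Function.Injective revIndex := by
  intro l
  induction l with
  | nil =>
    intro l' h
    cases l' with
    | nil => rfl
    | cons b l' =>
      simp only [revIndex, List.foldr_cons, List.foldr_nil] at h
      omega
  | cons a l ih =>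
    intro l' h
    cases l' with
    | nil => simp [revIndex] at h
    | cons b l' =>
      simp only [revIndex, List.foldr_cons] at h ih
      have hab : a = b := by cases a <;> cases b <;> simp at h ⊢ <;> omega
      subst hab
      rw [ih (a₂ := l') (by omega)]

theorem natStr_strIndex (x : List Bool) : natStr (strIndex x) = x := by
  have h := strIndex_natStr (strIndex x)
  generalize natStr (strIndex x) = y at h
  rw [← List.reverse_reverse y, ← List.reverse_reverse x, strIndex_reverse,
    strIndex_reverse] at h
  exact List.reverse_injective (revIndex_injective h)

theorem primrec_incr : Primrec incr := by
  have : Primrec fun l : List Bool => (List.rec [false]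
      (fun b l ih => bif b then false :: ih else true :: l) l : List Bool) := by
    refine Primrec.list_rec (h := fun _ p => bif p.1 then false :: p.2.2 else true :: p.2.1)
      Primrec.id (Primrec.const [false]) ?_
    refine Primrec.cond (Primrec.fst.comp Primrec.snd) ?_ ?_
    · exact Primrec.list_cons.comp (Primrec.const false)
        (Primrec.snd.comp (Primrec.snd.comp Primrec.snd))
    · exact Primrec.list_cons.comp (Primrec.const true)
        (Primrec.fst.comp (Primrec.snd.comp Primrec.snd))
  refine this.of_eq fun l => ?_
  induction l with
  | nil => rfl
  | cons b l ih => cases b <;> simp_all [incr]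

theorem primrec_natStr : Primrec natStr :=
  Primrec.list_reverse.comp
    (Primrec.nat_iterate Primrec.id (Primrec.const []) (primrec_incr.comp Primrec.snd).to₂)

/-! ### Lists of oracle queries written as strings -/

/-- The string that lists the queries `q` with the claimed answers `b`, for `(q, b) ∈ ps`. -/
def queryCode (ps : List (List Bool × Bool)) : List Bool :=
  ps.flatMap fun p => (p.1.flatMap fun c => [true, c]) ++ [false, p.2]

/-- Read a list of queries with claimed answers, of which the part `q` of the first query has
already been read, and check whether all the answers are those of the oracle `O`. -/
def scan (O : List Bool → Bool) : List Bool → List Bool → Bool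
  | _, [] => true
  | _, [_] => false
  | q, true :: c :: x => scan O (q ++ [c]) x
  | q, false :: b :: x => (O q == b) && scan O [] x

theorem scan_query (O : List Bool → Bool) (q p x : List Bool) :
    scan O q ((p.flatMap fun c => [true, c]) ++ x) = scan O (q ++ p) x := by
  induction p generalizing q with
  | nil => simp
  | cons c p ih => simp [scan, ih]

theorem scan_queryCode (O : List Bool → Bool) (ps : List (List Bool × Bool)) :
    scan O [] (queryCode ps) = ps.all fun p => O p.1 == p.2 := by
  induction ps with
  | nil => simp [queryCode, scan]
  | cons p ps ih =>
    rw [queryCode, List.flatMap_cons, List.append_assoc, scan_query]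
    simp only [List.cons_append, List.nil_append, scan, List.all_cons]
    rw [← ih, queryCode]

theorem length_le_length_queryCode (ps : List (List Bool × Bool)) :
    ps.length ≤ (queryCode ps).length := by
  induction ps with
  | nil => simp
  | cons p ps ih =>
    rw [queryCode, List.flatMap_cons] at *
    simp only [List.length_append, List.length_cons, List.length_nil]
    omega

/-- The string claiming that the oracle begins with `σ`. -/
def prefixCode (σ : List Bool) : List Bool :=
  queryCode ((List.range σ.length).map fun i => (natStr i, σ.getD i false))

/-- This bounds the index `n` by the input length in the search that decides `targetLanguage`. -/
theorem length_le_length_prefixCode (σ : List Bool) : σ.length ≤ (prefixCode σ).length := by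
  refine le_trans ?_ (length_le_length_queryCode _)
  simp

theorem scan_prefixCode (A : ℕ → Bool) (σ : List Bool) :
    scan (toOracle A) [] (prefixCode σ) = true ↔ A ∈ cylinder σ := by
  simp only [prefixCode, scan_queryCode, List.all_map, List.all_eq_true, List.mem_range,
    Function.comp_apply, toOracle, strIndex_natStr, beq_iff_eq, cylinder, Set.mem_ofPred_eq]
  refine forall_congr' fun i => forall_congr' fun h => ?_
  rw [List.getD_eq_getElem _ _ h]

theorem primrec_queryCode : Primrec queryCode := by
  refine Primrec.list_flatMap Primrec.id ?_
  refine Primrec.list_append.comp ?_ ?_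
  · refine Primrec.list_flatMap (Primrec.fst.comp Primrec.snd) ?_
    exact Primrec.list_cons.comp (Primrec.const true)
      (Primrec.list_cons.comp Primrec.snd (Primrec.const []))
  · exact Primrec.list_cons.comp (Primrec.const false)
      (Primrec.list_cons.comp (Primrec.snd.comp Primrec.snd) (Primrec.const []))

theorem primrec_prefixCode : Primrec prefixCode := by
  refine primrec_queryCode.comp (Primrec.list_map (Primrec.list_range.comp Primrec.list_length) ?_)
  exact Primrec.pair (primrec_natStr.comp Primrec.snd)
    ((Primrec.list_getD false).comp Primrec.fst Primrec.snd)

theorem mem_cylinder_map_range (A : ℕ → Bool) (n : ℕ) :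
    A ∈ cylinder ((List.range n).map A) := by
  intro i h
  simp

end LowForSpeed

namespace LowForSpeed

/-! ### A computable function that is infinitely often equal to each primitive recursive one -/

open Nat.Partrec (Code)
open Nat.Partrec.Code (evaln evaln_mono)

/-- Every primitive recursive function has a code for which a primitive recursive amount of fuel
suffices. -/
theorem exists_code_evaln {f : ℕ → ℕ} (hf : Nat.Primrec f) :
    ∃ (c : Code) (h : ℕ → ℕ), Nat.Primrec h ∧ ∀ n, f n ∈ evaln (h n) c n := by
  induction hf with
  | zero => exact ⟨.zero, Nat.succ, .succ, fun n => by simp [evaln]⟩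
  | succ => exact ⟨.succ, Nat.succ, .succ, fun n => by simp [evaln]⟩
  | left => exact ⟨.left, Nat.succ, .succ, fun n => by simp [evaln]⟩
  | right => exact ⟨.right, Nat.succ, .succ, fun n => by simp [evaln]⟩
  | @pair f g hf hg ihf ihg =>
    obtain ⟨cf, kf, pf, Hf⟩ := ihf
    obtain ⟨cg, kg, pg, Hg⟩ := ihg
    -- `evaln` with fuel `k + 1` only accepts arguments at most `k`, hence the summand `n + 1`.
    refine ⟨.pair cf cg, fun n => kf n + kg n + n + 1, ?_, fun n => ?_⟩
    · rw [← Primrec.nat_iff] at *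
      exact Primrec.succ.comp
        (Primrec.nat_add.comp (Primrec.nat_add.comp pf pg) Primrec.id)
    · have h1 := evaln_mono (show kf n ≤ kf n + kg n + n + 1 by omega) (Hf n)
      have h2 := evaln_mono (show kg n ≤ kf n + kg n + n + 1 by omega) (Hg n)
      rw [Option.mem_def] at *
      simp [evaln, h1, h2, Seq.seq]
  | @comp f g hf hg ihf ihg =>
    obtain ⟨cf, kf, pf, Hf⟩ := ihf
    obtain ⟨cg, kg, pg, Hg⟩ := ihg
    refine ⟨.comp cf cg, fun n => kf (g n) + kg n + n + 1, ?_, fun n => ?_⟩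
    · rw [← Primrec.nat_iff] at *
      exact Primrec.succ.comp
        (Primrec.nat_add.comp (Primrec.nat_add.comp (pf.comp hg) pg) Primrec.id)
    · have h1 := evaln_mono (show kf (g n) ≤ kf (g n) + kg n + n + 1 by omega) (Hf (g n))
      have h2 := evaln_mono (show kg n ≤ kf (g n) + kg n + n + 1 by omega) (Hg n)
      rw [Option.mem_def] at *
      simp [evaln, h1, h2]
  | @prec f g hf hg ihf ihg =>
    obtain ⟨cf, kf, pf, Hf⟩ := ihf
    obtain ⟨cg, kg, pg, Hg⟩ := ihg
    let v : ℕ → ℕ → ℕ := fun a m => m.rec (f a) fun y IH => g (Nat.pair a (Nat.pair y IH))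
    -- The recursive call of `prec` runs with one unit of fuel less, so the fuel is accumulated
    -- along the same recursion as the value.
    let B : ℕ → ℕ → ℕ := fun a m => m.rec (kf a + Nat.pair a 0 + 1) fun y IH =>
      IH + kg (Nat.pair a (Nat.pair y (v a y))) + Nat.pair a (y + 1) + 1
    have key : ∀ a m, v a m ∈ evaln (B a m) (.prec cf cg) (Nat.pair a m) := by
      intro a m
      induction m with
      | zero =>
        have hB : B a 0 = kf a + Nat.pair a 0 + 1 := rfl
        have h1 := evaln_mono (show kf a ≤ kf a + Nat.pair a 0 + 1 by omega) (Hf a)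
        rw [Option.mem_def] at *
        rw [hB]
        simp [evaln, h1, v]
      | succ m ih =>
        have hB : B a (m + 1) = B a m + kg (Nat.pair a (Nat.pair m (v a m)))
          + Nat.pair a (m + 1) + 1 := rfl
        have h1 := evaln_mono (show B a m ≤ B a m + kg (Nat.pair a (Nat.pair m (v a m)))
          + Nat.pair a (m + 1) by omega) ih
        have h2 := evaln_mono (show kg (Nat.pair a (Nat.pair m (v a m))) ≤ B a m +
          kg (Nat.pair a (Nat.pair m (v a m))) + Nat.pair a (m + 1) + 1 by omega) (Hg _)
        rw [Option.mem_def] at *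
        rw [hB]
        simp [evaln, h1, h2, v]
    refine ⟨.prec cf cg, fun n => B n.unpair.1 n.unpair.2, ?_, fun n => ?_⟩
    · rw [← Primrec.nat_iff] at *
      have hv : Primrec₂ v := by
        refine Primrec.nat_rec (g := fun a p => g (Nat.pair a (Nat.pair p.1 p.2))) hf ?_
        exact hg.comp (Primrec₂.natPair.comp Primrec.fst
          (Primrec₂.natPair.comp (Primrec.fst.comp Primrec.snd) (Primrec.snd.comp Primrec.snd)))
      have hB : Primrec₂ B := by
        refine Primrec.nat_rec (g := fun a p => p.2 + kg (Nat.pair a (Nat.pair p.1 (v a p.1))) +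
          Nat.pair a (p.1 + 1) + 1) ?_ ?_
        · exact Primrec.succ.comp (Primrec.nat_add.comp pf
            (Primrec₂.natPair.comp Primrec.id (Primrec.const 0)))
        · have h1 : Primrec fun p : ℕ × ℕ × ℕ => p.2.1 := Primrec.fst.comp Primrec.snd
          refine Primrec.succ.comp (Primrec.nat_add.comp (Primrec.nat_add.comp
            (Primrec.snd.comp Primrec.snd) (pg.comp (Primrec₂.natPair.comp Primrec.fst
              (Primrec₂.natPair.comp h1 (hv.comp Primrec.fst h1)))))
            (Primrec₂.natPair.comp Primrec.fst (Primrec.succ.comp h1)))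
      exact hB.comp (Primrec.fst.comp Primrec.unpair) (Primrec.snd.comp Primrec.unpair)
    · have := key n.unpair.1 n.unpair.2
      rw [Nat.pair_unpair] at this
      exact this

/-- A computable function that agrees infinitely often with each primitive recursive function. -/
def anticipate (n : ℕ) : ℕ :=
  (evaln (ack n.unpair.1.unpair.1 n) (Denumerable.ofNat Code n.unpair.1.unpair.2) n).getD 0

theorem computable_anticipate : Computable anticipate := by
  have h1 : Computable fun n : ℕ => n.unpair.1.unpair :=
    Computable.unpair.comp (Computable.fst.comp Computable.unpair)
  have h2 : Computable fun n : ℕ => ack n.unpair.1.unpair.1 n :=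
    computable₂_ack.comp (Computable.fst.comp h1) Computable.id
  have h3 : Computable fun n : ℕ => Denumerable.ofNat Code n.unpair.1.unpair.2 :=
    (Computable.ofNat Code).comp (Computable.snd.comp h1)
  exact Computable.option_getD
    (Nat.Partrec.Code.primrec_evaln.to_comp.comp ((h2.pair h3).pair Computable.id))
    (Computable.const 0)

/-- The fuel needed to compute `f` is primitive recursive, so it lies below a single row `m` of the
Ackermann function. -/
theorem frequently_anticipate_eq {f : ℕ → ℕ} (hf : Nat.Primrec f) (N : ℕ) :
    ∃ n ≥ N, anticipate n = f n := by
  obtain ⟨c, h, hh, H⟩ := exists_code_evaln hf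
  obtain ⟨m, hm⟩ := exists_lt_ack_of_nat_primrec hh
  -- The argument itself names the row and the program; `N` is padding that makes it large.
  refine ⟨Nat.pair (Nat.pair m (Encodable.encode c)) N, Nat.right_le_pair _ _, ?_⟩
  have := evaln_mono (hm (Nat.pair (Nat.pair m (Encodable.encode c)) N)).le (H _)
  rw [Option.mem_def] at this
  simp [anticipate, this]

/-- A computable sequence of strings, the `n`-th of length `n`, that agrees infinitely often with
each primitive recursive sequence of this kind. -/
def target (n : ℕ) : List Bool :=
  let τ := (Encodable.decode (α := List Bool) (anticipate n)).getD []
  -- The default keeps the length exact, which the measure estimates need even where nothing is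
  -- anticipated.
  if τ.length = n then τ else List.replicate n false

theorem length_target (n : ℕ) : (target n).length = n := by
  simp only [target]
  split_ifs with h
  · exact h
  · simp

theorem frequently_target_eq {F : ℕ → List Bool} (hF : Primrec F) (hl : ∀ n, (F n).length = n)
    (N : ℕ) : ∃ n ≥ N, target n = F n := by
  obtain ⟨n, hn, h⟩ := frequently_anticipate_eq
    (f := fun n => Encodable.encode (F n)) (Primrec.nat_iff.1 (Primrec.encode.comp hF)) N
  refine ⟨n, hn, ?_⟩
  simp [target, h, hl]

theorem computable_target : Computable target := by
  have h1 : Primrec fun p : ℕ × List Bool =>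
      if p.2.length = p.1 then p.2 else (List.range p.1).map fun _ => false := by
    refine Primrec.ite (Primrec.eq.comp (Primrec.list_length.comp Primrec.snd) Primrec.fst)
      Primrec.snd (Primrec.list_map (Primrec.list_range.comp Primrec.fst) (Primrec.const false).to₂)
  refine (h1.to_comp.comp (Computable.id.pair
    (Computable.option_getD (Computable.decode.comp computable_anticipate)
      (Computable.const [])))).of_eq fun n => ?_
  simp [target]

end LowForSpeed

namespace LowForSpeed

/-! ### Machines without oracle are primitive recursive -/

instance : Finite Move :=
  Finite.of_injective (β := Fin 3)
    (fun m => match m with | .left => 0 | .stay => 1 | .right => 2)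
    (by intro a b; cases a <;> cases b <;> simp)

/-- A finite type is primitively codable. -/
noncomputable abbrev primcodableOfFinite (α : Type) [Finite α] : Primcodable α :=
  Primcodable.ofEquiv (Fin (Nat.card α)) (Finite.equivFin α)

namespace OracleTM

attribute [instance] OracleTM.finQ OracleTM.finS

/-- The state and the work tapes of a configuration. -/
abbrev Core (M : OracleTM) : Type :=
  M.Q × (Fin (M.k + 1) → List (Symbol M.S) × List (Symbol M.S))

/-- Forget the query tape. -/
def core (M : OracleTM) (c : M.Cfg) : M.Core :=
  (c.state, fun i => ((c.tapes i).left, (c.tapes i).right))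

/-- The transition function, without query tape. -/
def coreTrans (M : OracleTM) (p : M.Q × (Fin (M.k + 1) → Symbol M.S)) :
    Bool ⊕ (M.Q × (Fin (M.k + 1) → Symbol M.S × Move)) :=
  match M.trans p.1 p.2 with
  | .halt b => Sum.inl b
  | .act q w _ => Sum.inr (q, w)
  -- A junk value: an oracle-free machine never gets here.
  | .query _ _ => Sum.inl false

/-- The action of one head on its tape. -/
def headAct {S : Type} (w : Symbol S × Move) (t : List (Symbol S) × List (Symbol S)) :
    List (Symbol S) × List (Symbol S) :=
  match w.2 with
  | .left => (t.1.tail, t.1.headD none :: w.1 :: t.2.tail)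
  | .stay => (t.1, w.1 :: t.2.tail)
  | .right => (w.1 :: t.1, t.2.tail)

/-- One step of a machine without oracle; halting configurations are fixed. -/
def coreStep (M : OracleTM) : Bool ⊕ M.Core → Bool ⊕ M.Core
  | Sum.inl b => Sum.inl b
  | Sum.inr c =>
    match M.coreTrans (c.1, fun i => (c.2 i).2.headD none) with
    | Sum.inl b => Sum.inl b
    | Sum.inr p => Sum.inr (p.1, fun i => headAct (p.2 i) (c.2 i))

theorem iterate_coreStep_inl (M : OracleTM) (t : ℕ) (b : Bool) :
    M.coreStep^[t] (Sum.inl b) = Sum.inl b :=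
  Function.iterate_fixed rfl t

/-- Only a query would read the query tape, so it can be forgotten. Since halting is absorbing, a
time-bounded run becomes a plain iterate. -/
theorem run_eq_iterate_coreStep {M : OracleTM} (hM : M.OracleFree) (O : List Bool → Bool)
    (t : ℕ) (c : M.Cfg) : M.run O t c = (M.coreStep^[t] (Sum.inr (M.core c))).getLeft? := by
  induction t generalizing c with
  | zero => rfl
  | succ t ih =>
    rw [Function.iterate_succ_apply]
    have hr : (fun i => ((M.core c).2 i).2.headD none) = fun i => (c.tapes i).read := rfl
    simp only [run, step, coreStep, coreTrans, hr]
    change (match (match M.trans c.state (fun i => (c.tapes i).read) with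
      | .halt b => _ | .act q w a => _ | .query yes no => _ : Bool ⊕ M.Cfg) with
      | Sum.inl b => _ | Sum.inr c' => _) = _
    cases h : M.trans c.state (fun i => (c.tapes i).read) with
    | halt b => simp [core, h, iterate_coreStep_inl]
    | act q w a =>
      simp only [ih]
      simp only [core, h]
      congr 4
      funext i
      rcases hw : (w i).2 <;> simp [headAct, hw, Tape.write, Tape.move]
    | query y n => exact absurd h (hM _ _ _ _)

section
variable {S : Type} [Primcodable S] [Primcodable Move]

theorem primrec_headAct : Primrec₂ (headAct (S := S)) := by
  classical
  have hw : Primrec fun p : (Symbol S × Move) × (List (Symbol S) × List (Symbol S)) => p.1.1 :=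
    Primrec.fst.comp Primrec.fst
  have hm : Primrec fun p : (Symbol S × Move) × (List (Symbol S) × List (Symbol S)) => p.1.2 :=
    Primrec.snd.comp Primrec.fst
  have hl : Primrec fun p : (Symbol S × Move) × (List (Symbol S) × List (Symbol S)) => p.2.1 :=
    Primrec.fst.comp Primrec.snd
  have hr : Primrec fun p : (Symbol S × Move) × (List (Symbol S) × List (Symbol S)) => p.2.2 :=
    Primrec.snd.comp Primrec.snd
  have ht := Primrec.list_cons.comp hw (Primrec.list_tail.comp hr)
  have hh := Primrec.option_getD.comp (Primrec.list_head?.comp hl) (Primrec.const none)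
  refine (Primrec.ite (Primrec.eq.comp hm (Primrec.const Move.left))
    (Primrec.pair (Primrec.list_tail.comp hl) (Primrec.list_cons.comp hh ht))
    (Primrec.ite (Primrec.eq.comp hm (Primrec.const Move.stay)) (Primrec.pair hl ht)
      (Primrec.pair (Primrec.list_cons.comp hw hl) (Primrec.list_tail.comp hr)))).of_eq ?_
  rintro ⟨⟨a, m⟩, l, r⟩
  cases m <;> cases l <;> simp [headAct]

end

/-- The transition table is finite and the heads act by elementary list operations, so one step is
primitive recursive; the time bound is the number of iterations. -/
theorem primrec_run {M : OracleTM} (hM : M.OracleFree) (O : List Bool → Bool) :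
    Primrec₂ fun (t : ℕ) (x : List Bool) => M.run O t (M.init x) := by
  let _ := primcodableOfFinite M.Q
  let _ := primcodableOfFinite M.S
  let _ := primcodableOfFinite Move
  have hc : Primrec fun x : List Bool => (Sum.inr (M.core (M.init x)) : Bool ⊕ M.Core) := by
    refine Primrec.sumInr.comp (Primrec.pair (Primrec.const _) (Primrec.fin_curry.2 ?_))
    classical
    refine (Primrec.ite (Primrec.eq.comp Primrec.snd (Primrec.const 0))
      (Primrec.pair (Primrec.const []) (Primrec.list_map Primrec.fst
        (Primrec.option_some.comp (Primrec.sumInl.comp Primrec.snd)).to₂))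
      (Primrec.const ([], []))).of_eq ?_
    rintro ⟨x, i⟩
    by_cases h : i = 0 <;> simp [init, h]
  have hread : Primrec fun c : M.Core =>
      (fun i => (c.2 i).2.headD none : Fin (M.k + 1) → Symbol M.S) := by
    refine Primrec.fin_curry.2 ?_
    have h1 : Primrec fun p : M.Core × Fin (M.k + 1) => p.1.2 p.2 :=
      Primrec.fin_app.comp (Primrec.snd.comp Primrec.fst) Primrec.snd
    refine (Primrec.option_getD.comp (Primrec.list_head?.comp (Primrec.snd.comp h1))
      (Primrec.const none)).of_eq fun p => ?_
    simp [List.headD_eq_head?_getD]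
  have htrans : Primrec M.coreTrans := Primrec.dom_finite _
  have hact : Primrec₂ fun (c : M.Core) (p : M.Q × (Fin (M.k + 1) → Symbol M.S × Move)) =>
      (p.1, fun i => headAct (p.2 i) (c.2 i)) := by
    refine Primrec.pair (Primrec.fst.comp Primrec.snd) (Primrec.fin_curry.2 ?_)
    exact primrec_headAct.comp
      (Primrec.fin_app.comp (Primrec.snd.comp (Primrec.snd.comp Primrec.fst)) Primrec.snd)
      (Primrec.fin_app.comp (Primrec.snd.comp (Primrec.fst.comp Primrec.fst)) Primrec.snd)
  have hstep : Primrec M.coreStep := by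
    refine (Primrec.sumCasesOn (f := id) (g := fun _ b => Sum.inl b)
      (h := fun _ c => Sum.casesOn (M.coreTrans (c.1, fun i => (c.2 i).2.headD none))
        (fun b => Sum.inl b) fun p => Sum.inr (p.1, fun i => headAct (p.2 i) (c.2 i)))
      Primrec.id (Primrec.sumInl.comp Primrec.snd).to₂ ?_).of_eq ?_
    · refine Primrec.sumCasesOn (htrans.comp (Primrec.pair (Primrec.fst.comp Primrec.snd)
        (hread.comp Primrec.snd))) (Primrec.sumInl.comp Primrec.snd).to₂ ?_
      exact (Primrec.sumInr.comp (hact.comp (Primrec.snd.comp Primrec.fst) Primrec.snd)).to₂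
    · rintro (b | c)
      · rfl
      · simp only [id, coreStep]
        cases M.coreTrans (c.1, fun i => (c.2 i).2.headD none) <;> rfl
  have hleft : Primrec (Sum.getLeft? : Bool ⊕ M.Core → Option Bool) := by
    refine (Primrec.sumCasesOn Primrec.id (Primrec.option_some.comp Primrec.snd).to₂
      (Primrec.const none).to₂).of_eq ?_
    rintro (b | c) <;> rfl
  refine (hleft.comp (Primrec.nat_iterate Primrec.fst (hc.comp Primrec.snd)
    (hstep.comp Primrec.snd).to₂)).of_eq ?_
  rintro ⟨t, x⟩
  exact (run_eq_iterate_coreStep hM O t _).symm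

end OracleTM
end LowForSpeed

namespace LowForSpeed

/-! ### Computable languages are decided by Post–Turing machines -/

open Turing

/-- A Post–Turing machine with finitely many states and symbols, together with an encoding of
binary strings on its tape and a way to read off an answer. -/
structure TapeDecider : Type 1 where
  /-- tape symbols -/
  Γ : Type
  /-- states -/
  Λ : Type
  [inhabitedΓ : Inhabited Γ]
  [fintypeΓ : Fintype Γ]
  [inhabitedΛ : Inhabited Λ]
  [fintypeΛ : Fintype Λ]
  /-- the transition function -/
  M : TM0.Machine Γ Λ
  /-- the symbol in the leftmost cell of the input -/
  bot : Γ
  /-- the second symbol of the input -/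
  lead : Γ
  /-- the symbols for the two bits -/
  enc : Bool → Γ
  /-- recognizes the leftmost cell of the input -/
  isBot : Γ → Bool
  /-- reads off the answer, in the cell to the right of the final head position -/
  ans : Γ → Bool
  isBot_bot : isBot bot = true
  isBot_lead : isBot lead = false
  isBot_enc : ∀ b, isBot (enc b) = false

attribute [instance] TapeDecider.inhabitedΓ TapeDecider.fintypeΓ TapeDecider.inhabitedΛ
  TapeDecider.fintypeΛ

/-- The tape decider `D` computes the Boolean function `h`. -/
def TapeDecider.Computes (D : TapeDecider) (h : List Bool → Bool) : Prop :=
  ∀ x : List Bool, ∃ c : TM0.Cfg D.Γ D.Λ,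
    c ∈ StateTransition.eval (TM0.step D.M)
      (TM0.init (D.bot :: D.lead :: x.map D.enc)) ∧
    D.ans (c.Tape.move Dir.right).head = h x

/-- The positive number whose binary digits are `1` followed by `x`. -/
def leadingOne (x : List Bool) : PosNum :=
  x.foldl (fun p b => bif b then p.bit1 else p.bit0) 1

theorem cast_leadingOne (x : List Bool) : (leadingOne x : ℕ) = strIndex x + 1 := by
  induction x using List.reverseRecOn with
  | nil => rfl
  | append_singleton x b ih =>
    simp only [leadingOne, strIndex, List.foldl_append, List.foldl_cons, List.foldl_nil] at ih ⊢
    cases b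
    · rw [cond_false, PosNum.cast_bit0, ih, Bool.toNat_false]; ring
    · rw [cond_true, PosNum.cast_bit1, ih, Bool.toNat_true]; ring

/-- The index plus one has binary expansion `1x`. The tape input for this number is therefore a
fixed beginning followed by a bitwise translation of `x`, which a machine can write while it reads
`x`. -/
theorem trNat_strIndex (x : List Bool) :
    PartrecToTM2.trNat (strIndex x + 1) = (PartrecToTM2.Γ'.bit1 :: x.map fun b =>
      bif b then PartrecToTM2.Γ'.bit1 else PartrecToTM2.Γ'.bit0).reverse := by
  rw [← cast_leadingOne, PartrecToTM2.trNat, PosNum.of_to_nat]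
  change PartrecToTM2.trPosNum _ = _
  induction x using List.reverseRecOn with
  | nil => rfl
  | append_singleton x b ih =>
    simp only [leadingOne, List.foldl_append, List.foldl_cons, List.foldl_nil, List.map_append,
      List.map_cons, List.map_nil, List.reverse_cons, List.reverse_append, List.reverse_nil,
      List.nil_append, List.cons_append] at ih ⊢
    cases b <;> simp [PartrecToTM2.trPosNum, ih]

theorem exists_code_eval {h : List Bool → Bool} (hh : Computable h) :
    ∃ c : ToPartrec.Code, ∀ x, c.eval [strIndex x + 1] = Part.some [(h x).toNat] := by
  have h1 : Computable fun n : ℕ => (h (natStr (n - 1))).toNat :=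
    (Primrec.dom_finite Bool.toNat).to_comp.comp (hh.comp (primrec_natStr.comp
      Primrec.pred).to_comp)
  obtain ⟨c, hc⟩ := ToPartrec.Code.exists_code (Nat.Partrec'.part_iff₁.2 h1)
  refine ⟨c, fun x => ?_⟩
  have := hc ((strIndex x + 1) ::ᵥ List.Vector.nil)
  simp only [List.Vector.head_cons, PFun.coe_val, Nat.add_sub_cancel, natStr_strIndex] at this
  rw [Part.map_eq_map, Part.map_some] at this
  exact this

instance : Fintype PartrecToTM2.K' :=
  ⟨{.main, .rev, .aux, .stack}, fun k => by cases k <;> simp⟩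

/-- Restriction of a Post–Turing machine to a set of states that supports it. -/
def restrictMachine {Γ Λ : Type} [Inhabited Λ] (M : TM0.Machine Γ Λ) (S : Set Λ)
    (hS : TM0.Supports M S) :
    @TM0.Machine Γ S ⟨⟨default, hS.1⟩⟩ :=
  fun q a => (M q.1 a).pmap (fun p hp => (⟨p.1, hp⟩, p.2))
    (fun _ hp => hS.2 hp q.2)

/-- The machines produced by the general translations have infinite state types, but a finite set
supports the computation. Restricting to it changes no step. -/
theorem restrictMachine_respects {Γ Λ : Type} [Inhabited Γ] [Inhabited Λ] (M : TM0.Machine Γ Λ)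
    (S : Set Λ) (hS : TM0.Supports M S) :
    letI : Inhabited S := ⟨⟨default, hS.1⟩⟩
    StateTransition.Respects (TM0.step M) (TM0.step (restrictMachine M S hS))
      fun c c' => c.q = c'.q.1 ∧ c.Tape = c'.Tape := by
  let _ : Inhabited S := ⟨⟨default, hS.1⟩⟩
  rintro ⟨q, T⟩ ⟨q', T'⟩ ⟨h, h'⟩
  simp only at h h'
  subst h h'
  cases e : M q'.1 T.head with
  | none =>
    have e' : restrictMachine M S hS q' T.head = none := by simp [restrictMachine, e]
    simp [TM0.step, e, e']
  | some p =>
    have e' : restrictMachine M S hS q' T.head = some (⟨p.1, hS.2 e q'.2⟩, p.2) := by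
      simp [restrictMachine, e]
    simp only [TM0.step, e, Option.map_some]
    refine ⟨⟨⟨p.1, hS.2 e q'.2⟩, _⟩, ⟨rfl, rfl⟩, Relation.TransGen.single ?_⟩
    change Option.map _ (restrictMachine M S hS q' T.head) = _
    rw [e']
    rfl

open PartrecToTM2 in
theorem exists_tapeDecider {h : List Bool → Bool} (hh : Computable h) :
    ∃ D : TapeDecider, D.Computes h := by
  classical
  obtain ⟨c, hc⟩ := exists_code_eval hh
  -- The default state serves as the initial state, so it has to be the entry point of the program
  -- `c`.
  let _ : Inhabited PartrecToTM2.Λ' := ⟨trNormal c Cont'.halt⟩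
  let M1 := TM2to1.tr PartrecToTM2.tr
  let M0 := TM1to0.tr M1
  have hsupp : TM0.Supports M0 _ :=
    TM1to0.tr_supports M1 (TM2to1.tr_supports PartrecToTM2.tr (tr_supports c Cont'.halt))
  generalize TM1to0.trStmts M1 (TM2to1.trSupp PartrecToTM2.tr (codeSupp c Cont'.halt)) = S at hsupp
  let _ : Inhabited (S : Set (TM1to0.Λ' M1)) := ⟨⟨default, hsupp.1⟩⟩
  let sym : PartrecToTM2.Γ' → ∀ _ : K', Option PartrecToTM2.Γ' := fun a =>
    Function.update (fun _ => none) K'.main (some a)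
  let bit : Bool → PartrecToTM2.Γ' := fun b => bif b then .bit1 else .bit0
  let D : TapeDecider :=
    { Γ := TM2to1.Γ' K' fun _ => PartrecToTM2.Γ'
      Λ := (S : Set (TM1to0.Λ' M1))
      M := restrictMachine M0 S hsupp
      bot := (true, sym .cons)
      lead := (false, sym .bit1)
      enc := fun b => (false, sym (bit b))
      isBot := fun a => a.1
      ans := fun a => decide (a.2 K'.main = some .bit1)
      isBot_bot := rfl
      isBot_lead := rfl
      isBot_enc := fun _ => rfl }
  refine ⟨D, fun x => ?_⟩
  have htape : TM2to1.trInit (Γ := fun _ : K' => PartrecToTM2.Γ') K'.main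
      (trList [strIndex x + 1]) = D.bot :: D.lead :: x.map D.enc := by
    simp only [trList, trNat_strIndex, TM2to1.trInit, List.reverse_append, List.reverse_cons,
      List.reverse_reverse]
    exact congrArg (fun l => D.bot :: D.lead :: l)
      (List.map_map (f := bit) (g := fun a => ((false, sym a) : D.Γ)) (l := x))
  have hinit : TM2.init K'.main (trList [strIndex x + 1]) =
      PartrecToTM2.init c [strIndex x + 1] := by
    simp only [TM2.init, PartrecToTM2.init]
    congr 1
    funext k
    cases k <;> rfl
  have heval : PartrecToTM2.halt [(h x).toNat] ∈ StateTransition.eval (TM2.step PartrecToTM2.tr)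
      (TM2.init K'.main (trList [strIndex x + 1])) := by
    rw [hinit, PartrecToTM2.tr_eval, hc]
    rw [Part.map_eq_map, Part.map_some]
    exact Part.mem_some _
  obtain ⟨c1, hc1, he1⟩ := StateTransition.tr_eval (TM2to1.tr_respects PartrecToTM2.tr)
    (TM2to1.trCfg_init K'.main _) heval
  obtain ⟨c0, rfl, he0⟩ := StateTransition.tr_eval (TM1to0.tr_respects M1) rfl he1
  obtain ⟨c', ⟨hq, hT⟩, he'⟩ := StateTransition.tr_eval (restrictMachine_respects M0 S hsupp)
    (a₂ := TM0.init (D.bot :: D.lead :: x.map D.enc)) ⟨rfl, by rw [htape]; rfl⟩ he0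
  refine ⟨c', he', ?_⟩
  rw [← hT]
  obtain ⟨L, hL⟩ := hc1
  have hnth : (Turing.Tape.move Dir.right (Turing.Tape.mk' ∅ (TM2to1.addBottom L))).head =
      (TM2to1.addBottom L).nth 1 := by
    have := Turing.Tape.move_right_n_head (Turing.Tape.mk' ∅ (TM2to1.addBottom L)) 1
    rw [Function.iterate_one] at this
    rw [this, Turing.Tape.mk'_nth_nat]
  -- Stacks lie on the tape bottom first: the output `0` is only a separator in cell `0`, while the
  -- output `1` has a further `bit1` in cell `1`.
  have hcell : ((TM2to1.addBottom L).nth 1).2 K'.main = (trList [(h x).toNat]).reverse[1]? := by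
    rw [TM2to1.addBottom_nth_snd, TM2to1.stk_nth_val 1 (hL K'.main)]
    rfl
  have hans : decide (((TM2to1.addBottom L).nth 1).2 K'.main = some Γ'.bit1) = h x := by
    simp only [hcell]
    cases h x
    · simp
    · have : trNat 1 = [.bit1] := rfl
      simp [this]
  exact (congrArg D.ans hnth).trans hans

end LowForSpeed

namespace LowForSpeed

/-! ### A machine that is fast on the prefixes of its oracle -/

open Turing

/-- The states of `prefixMachine`. -/
inductive Phase (Λ : Type) : Type
  /-- write the leftmost symbol of the input of the tape decider -/
  | bot
  /-- write the second symbol of the input of the tape decider -/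
  | lead
  /-- read the first symbol of a pair -/
  | tag
  /-- read a bit and append it to the query tape -/
  | app
  /-- query the oracle -/
  | ask
  /-- compare the answer with the next bit of the input -/
  | cmp (answer : Bool)
  /-- copy the rest of the input -/
  | rest
  /-- go back to the leftmost symbol -/
  | rew
  /-- simulate the tape decider -/
  | sim (q : Λ)
  /-- read off the answer of the tape decider -/
  | fin

instance (Λ : Type) [Finite Λ] : Finite (Phase Λ) :=
  Finite.of_injective (β := (Fin 8 ⊕ Bool) ⊕ Λ)
    (fun s => match s with
      | .bot => .inl (.inl 0) | .lead => .inl (.inl 1) | .tag => .inl (.inl 2)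
      | .app => .inl (.inl 3) | .ask => .inl (.inl 4) | .rest => .inl (.inl 5)
      | .rew => .inl (.inl 6) | .fin => .inl (.inl 7) | .cmp b => .inl (.inr b)
      | .sim q => .inr q)
    (by intro a b; cases a <;> cases b <;> simp)

/-- The symbol of the tape decider written in a cell. -/
def symVal {Γ : Type} [Inhabited Γ] : Symbol Γ → Γ
  | some (Sum.inr g) => g
  | _ => default

/-- A symbol of the tape decider as a tape symbol. -/
def put {Γ : Type} (g : Γ) : Symbol Γ := some (Sum.inr g)

@[simp] theorem symVal_put {Γ : Type} [Inhabited Γ] (g : Γ) : symVal (put g) = g := rfl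

@[simp] theorem symVal_none {Γ : Type} [Inhabited Γ] : symVal (none : Symbol Γ) = default := rfl

/-- A direction as a head movement. -/
def dirMove : Dir → Move
  | .left => .left
  | .right => .right

/-- The transition function of `prefixMachine`. -/
def prefixTrans (D : TapeDecider) :
    Phase D.Λ → Symbol D.Γ → Symbol D.Γ → Action (Phase D.Λ) D.Γ 1
  | .bot, a, _ => .act .lead ![(a, .stay), (put D.bot, .right)] none
  | .lead, a, _ => .act .tag ![(a, .stay), (put D.lead, .right)] none
  -- Each input bit is translated onto the second tape as soon as it is consumed, so the decider's
  -- input is complete once the end is reached.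
  | .tag, some (Sum.inl true), _ =>
    .act .app ![(some (Sum.inl true), .right), (put (D.enc true), .right)] none
  | .tag, some (Sum.inl false), _ =>
    .act .ask ![(some (Sum.inl false), .right), (put (D.enc false), .right)] none
  -- On inputs of bits, the blank is met here only after complete pairs without a false claim.
  | .tag, _, _ => .halt false
  | .app, some (Sum.inl b), _ =>
    .act .tag ![(some (Sum.inl b), .right), (put (D.enc b), .right)] (some b)
  | .app, a, a' => .act .rew ![(a, .stay), (a', .left)] none
  | .ask, _, _ => .query (.cmp true) (.cmp false)
  | .cmp c, some (Sum.inl b), _ =>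
    .act (if c = b then .tag else .rest)
      ![(some (Sum.inl b), .right), (put (D.enc b), .right)] none
  | .cmp _, a, a' => .act .rew ![(a, .stay), (a', .left)] none
  | .rest, some (Sum.inl b), _ =>
    .act .rest ![(some (Sum.inl b), .right), (put (D.enc b), .right)] none
  | .rest, a, a' => .act .rew ![(a, .stay), (a', .left)] none
  | .rew, a, a' =>
    if D.isBot (symVal a') then .act (.sim default) ![(a, .stay), (a', .stay)] none
    else .act .rew ![(a, .stay), (a', .left)] none
  | .sim q, a, a' =>
    match D.M q (symVal a') with
    | none => .act .fin ![(a, .stay), (a', .right)] none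
    | some (q', .move d) => .act (.sim q') ![(a, .stay), (a', dirMove d)] none
    | some (q', .write g) => .act (.sim q') ![(a, .stay), (put g, .stay)] none
  | .fin, _, a' => .halt (D.ans (symVal a'))

/-- The machine that reads its input as a list of queries with claimed answers and rejects if all
of them are correct; otherwise it simulates the tape decider `D` on its input. -/
noncomputable def prefixMachine (D : TapeDecider) : OracleTM where
  Q := Phase D.Λ
  finQ := Fintype.ofFinite _
  S := D.Γ
  k := 1
  start := .bot
  trans q a := prefixTrans D q (a 0) (a 1)

namespace OracleTM

/-- The machine `M` with oracle `O`, started in the configuration `c`, halts with answer `b`. -/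
def Halts (M : OracleTM) (O : List Bool → Bool) (c : M.Cfg) (b : Bool) : Prop :=
  ∃ t, M.run O t c = some b

theorem run_succ_of_step {M : OracleTM} {O : List Bool → Bool} {c c' : M.Cfg}
    (h : M.step O c = Sum.inr c') (t : ℕ) : M.run O (t + 1) c = M.run O t c' := by
  simp [run, h]

theorem run_succ_of_halt {M : OracleTM} {O : List Bool → Bool} {c : M.Cfg} {b : Bool}
    (h : M.step O c = Sum.inl b) (t : ℕ) : M.run O (t + 1) c = some b := by
  simp [run, h]

theorem Halts.of_step {M : OracleTM} {O : List Bool → Bool} {c c' : M.Cfg} {b : Bool}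
    (h : M.step O c = Sum.inr c') (hc : M.Halts O c' b) : M.Halts O c b := by
  obtain ⟨t, ht⟩ := hc
  exact ⟨t + 1, by rw [run_succ_of_step h, ht]⟩

theorem run_mono {M : OracleTM} {O : List Bool → Bool} {t t' : ℕ} (htt : t ≤ t') {c : M.Cfg}
    {b : Bool} (h : M.run O t c = some b) : M.run O t' c = some b := by
  induction t generalizing c t' with
  | zero => simp [run] at h
  | succ t ih =>
    obtain ⟨t', rfl⟩ := Nat.exists_eq_succ_of_ne_zero (show t' ≠ 0 by omega)
    cases hs : M.step O c with
    | inl b' =>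
      rw [run_succ_of_halt hs] at h ⊢
      exact h
    | inr c' =>
      rw [run_succ_of_step hs] at h
      rw [Nat.succ_eq_add_one, run_succ_of_step hs]
      exact ih (by omega) h

end OracleTM

/-! ### Step-by-step analysis of `prefixMachine` -/

section
variable (D : TapeDecider)

/-- A configuration of `prefixMachine`. -/
noncomputable def prefixCfg (s : Phase D.Λ) (t₀ t₁ : Tape D.Γ) (q : List Bool) : (prefixMachine D).Cfg where
  state := s
  tapes := ![t₀, t₁]
  query := q

variable {D} {O : List Bool → Bool} {b : Bool}

theorem step_act {s s' : Phase D.Λ} {t₀ t₁ : Tape D.Γ} {q : List Bool}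
    {w₀ w₁ : Symbol D.Γ × Move} {a : Option Bool}
    (h : prefixTrans D s t₀.read t₁.read = .act s' ![w₀, w₁] a) :
    (prefixMachine D).step O (prefixCfg D s t₀ t₁ q) =
      Sum.inr (prefixCfg D s' ((t₀.write w₀.1).move w₀.2) ((t₁.write w₁.1).move w₁.2)
        (q ++ a.toList)) := by
  have h' : (prefixMachine D).trans (prefixCfg D s t₀ t₁ q).state
      (fun i => ((prefixCfg D s t₀ t₁ q).tapes i).read) = .act s' ![w₀, w₁] a := h
  unfold OracleTM.step
  rw [h']
  refine congrArg Sum.inr ?_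
  unfold prefixCfg
  congr 1
  funext i
  revert i
  exact Fin.forall_fin_two.2 ⟨rfl, rfl⟩

theorem step_halt {s : Phase D.Λ} {t₀ t₁ : Tape D.Γ} {q : List Bool}
    (h : prefixTrans D s t₀.read t₁.read = .halt b) :
    (prefixMachine D).step O (prefixCfg D s t₀ t₁ q) = Sum.inl b := by
  have h' : (prefixMachine D).trans (prefixCfg D s t₀ t₁ q).state
      (fun i => ((prefixCfg D s t₀ t₁ q).tapes i).read) = .halt b := h
  unfold OracleTM.step
  rw [h']

theorem step_ask {t₀ t₁ : Tape D.Γ} {q : List Bool} :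
    (prefixMachine D).step O (prefixCfg D .ask t₀ t₁ q) =
      Sum.inr (prefixCfg D (.cmp (O q)) t₀ t₁ []) := by
  refine congrArg Sum.inr ?_
  change prefixCfg D (if O q then .cmp true else .cmp false) t₀ t₁ [] = _
  cases O q <;> rfl

/-- A bit string as tape contents. -/
def bits {Γ : Type} (x : List Bool) : List (Symbol Γ) := x.map fun b => some (Sum.inl b)

theorem init_prefixMachine (x : List Bool) :
    (prefixMachine D).init x = prefixCfg D .bot ⟨[], bits x⟩ ⟨[], []⟩ [] := by
  unfold OracleTM.init prefixCfg
  congr 1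
  funext i
  revert i
  exact Fin.forall_fin_two.2 ⟨rfl, rfl⟩

theorem step_bot {t₀ : Tape D.Γ} {q : List Bool} :
    (prefixMachine D).step O (prefixCfg D .bot t₀ ⟨[], []⟩ q) =
      Sum.inr (prefixCfg D .lead (t₀.write t₀.read) ⟨[put D.bot], []⟩ q) :=
  (step_act rfl).trans (by simp [Tape.write, Tape.move])

theorem step_lead {t₀ : Tape D.Γ} {l : List (Symbol D.Γ)} {q : List Bool} :
    (prefixMachine D).step O (prefixCfg D .lead t₀ ⟨l, []⟩ q) =
      Sum.inr (prefixCfg D .tag (t₀.write t₀.read) ⟨put D.lead :: l, []⟩ q) :=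
  (step_act rfl).trans (by simp [Tape.write, Tape.move])

variable {l l' : List (Symbol D.Γ)} {x q : List Bool}

theorem step_tag_true :
    (prefixMachine D).step O (prefixCfg D .tag ⟨l, bits (true :: x)⟩ ⟨l', []⟩ q) =
      Sum.inr (prefixCfg D .app ⟨some (Sum.inl true) :: l, bits x⟩
        ⟨put (D.enc true) :: l', []⟩ q) :=
  (step_act rfl).trans (by simp [Tape.write, Tape.move, bits])

theorem step_tag_false :
    (prefixMachine D).step O (prefixCfg D .tag ⟨l, bits (false :: x)⟩ ⟨l', []⟩ q) =
      Sum.inr (prefixCfg D .ask ⟨some (Sum.inl false) :: l, bits x⟩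
        ⟨put (D.enc false) :: l', []⟩ q) :=
  (step_act rfl).trans (by simp [Tape.write, Tape.move, bits])

theorem step_app {c : Bool} :
    (prefixMachine D).step O (prefixCfg D .app ⟨l, bits (c :: x)⟩ ⟨l', []⟩ q) =
      Sum.inr (prefixCfg D .tag ⟨some (Sum.inl c) :: l, bits x⟩
        ⟨put (D.enc c) :: l', []⟩ (q ++ [c])) :=
  (step_act rfl).trans (by simp [Tape.write, Tape.move, bits])

theorem step_cmp {a c : Bool} :
    (prefixMachine D).step O (prefixCfg D (.cmp a) ⟨l, bits (c :: x)⟩ ⟨l', []⟩ q) =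
      Sum.inr (prefixCfg D (if a = c then .tag else .rest) ⟨some (Sum.inl c) :: l, bits x⟩
        ⟨put (D.enc c) :: l', []⟩ q) :=
  (step_act rfl).trans (by simp [Tape.write, Tape.move, bits])

theorem step_rest {c : Bool} :
    (prefixMachine D).step O (prefixCfg D .rest ⟨l, bits (c :: x)⟩ ⟨l', []⟩ q) =
      Sum.inr (prefixCfg D .rest ⟨some (Sum.inl c) :: l, bits x⟩
        ⟨put (D.enc c) :: l', []⟩ q) :=
  (step_act rfl).trans (by simp [Tape.write, Tape.move, bits])

/-- If all the claimed answers are correct, then `prefixMachine` rejects in linear time. -/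
theorem run_tag_of_scan (h : scan O q x = true) (l l' : List (Symbol D.Γ)) :
    (prefixMachine D).run O (2 * x.length + 1)
      (prefixCfg D .tag ⟨l, bits x⟩ ⟨l', []⟩ q) = some false := by
  induction q, x using scan.induct generalizing l l' with
  | case1 q => exact OracleTM.run_succ_of_halt (step_halt rfl) _
  | case2 q c => simp [scan] at h
  | case3 q c x ih =>
    rw [scan] at h
    refine OracleTM.run_mono (t := 2 * x.length + 1 + 1 + 1)
      (by simp only [List.length_cons]; omega) ?_
    rw [OracleTM.run_succ_of_step step_tag_true, OracleTM.run_succ_of_step step_app]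
    exact ih h _ _
  | case4 q c x ih =>
    rw [scan, Bool.and_eq_true, beq_iff_eq] at h
    -- The two symbols closing a query cost three steps (tag, query, comparison); the budget grants
    -- four.
    refine OracleTM.run_mono (t := 2 * x.length + 1 + 1 + 1 + 1)
      (by simp only [List.length_cons]; omega) ?_
    rw [OracleTM.run_succ_of_step step_tag_false, OracleTM.run_succ_of_step step_ask,
      OracleTM.run_succ_of_step step_cmp, if_pos h.1]
    exact ih h.2 _ _

/-- In these phases the end of the input starts the rewinding. The scanned blank is rewritten before
the head moves, which leaves the explicit `none` on the second tape. -/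
theorem halts_of_blank {s : Phase D.Λ} (hs : s = .app ∨ s = .rest ∨ ∃ a, s = .cmp a)
    (H : ∀ t₀ q, (prefixMachine D).Halts O
      (prefixCfg D .rew t₀ (Tape.move .left ⟨l', [none]⟩) q) b) :
    (prefixMachine D).Halts O (prefixCfg D s ⟨l, []⟩ ⟨l', []⟩ q) b := by
  obtain rfl | rfl | ⟨a, rfl⟩ := hs
  all_goals
    refine OracleTM.Halts.of_step (step_act rfl) ?_
    exact H _ _

theorem halts_rest (H : ∀ t₀ q, (prefixMachine D).Halts O (prefixCfg D .rew t₀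
      (Tape.move .left ⟨(x.map fun c => put (D.enc c)).reverse ++ l', [none]⟩) q) b) :
    (prefixMachine D).Halts O (prefixCfg D .rest ⟨l, bits x⟩ ⟨l', []⟩ q) b := by
  induction x generalizing l l' with
  | nil => exact halts_of_blank (.inr (.inl rfl)) H
  | cons c x ih =>
    refine OracleTM.Halts.of_step step_rest (ih fun t₀ q => ?_)
    simpa using H t₀ q

/-- If one of the claimed answers is wrong, then `prefixMachine` copies its input and rewinds. -/
theorem halts_tag (h : scan O q x = false)
    (H : ∀ t₀ q, (prefixMachine D).Halts O (prefixCfg D .rew t₀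
      (Tape.move .left ⟨(x.map fun c => put (D.enc c)).reverse ++ l', [none]⟩) q) b) :
    (prefixMachine D).Halts O (prefixCfg D .tag ⟨l, bits x⟩ ⟨l', []⟩ q) b := by
  induction q, x using scan.induct generalizing l l' with
  | case1 q => simp [scan] at h
  | case2 q c =>
    cases c
    · refine .of_step step_tag_false (.of_step step_ask ?_)
      exact halts_of_blank (.inr (.inr ⟨_, rfl⟩)) H
    · refine .of_step step_tag_true ?_
      exact halts_of_blank (.inl rfl) H
  | case3 q c x ih =>
    rw [scan] at h
    refine .of_step step_tag_true (.of_step step_app (ih h fun t₀ q => ?_))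
    simpa using H t₀ q
  | case4 q c x ih =>
    rw [scan, Bool.and_eq_false_iff] at h
    refine .of_step step_tag_false (.of_step step_ask (.of_step step_cmp ?_))
    by_cases hc : O q = c
    · rw [if_pos hc]
      refine ih (h.resolve_left (by simp [hc])) fun t₀ q => ?_
      simpa using H t₀ q
    · rw [if_neg hc]
      refine halts_rest fun t₀ q => ?_
      simpa using H t₀ q

/-- The head travels left, so the induction removes symbols from the right end; only the bottom
marker stops it. -/
theorem halts_rew {ds : List D.Γ} (hds : ∀ d ∈ ds, D.isBot d = false)
    (r : List (Symbol D.Γ))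
    (H : ∀ t₀ q, (prefixMachine D).Halts O (prefixCfg D (.sim default) t₀
      ⟨[], put D.bot :: (ds.map put ++ r)⟩ q) b) (t₀ : Tape D.Γ) (q : List Bool) :
    (prefixMachine D).Halts O (prefixCfg D .rew t₀
      (Tape.move .left ⟨(ds.map put).reverse ++ [put D.bot], r⟩) q) b := by
  induction ds using List.reverseRecOn generalizing r t₀ q with
  | nil =>
    have h : prefixTrans D .rew t₀.read (put D.bot) =
        .act (.sim default) ![(t₀.read, .stay), (put D.bot, .stay)] none := by
      simp [prefixTrans, D.isBot_bot]
    exact .of_step (step_act (t₁ := ⟨[], put D.bot :: r⟩) h) (H _ _)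
  | append_singleton ds d ih =>
    have h : prefixTrans D .rew t₀.read (put d) =
        .act .rew ![(t₀.read, .stay), (put d, .left)] none := by
      simp [prefixTrans, hds d (by simp)]
    have h' := step_act (O := O) (q := q)
      (t₁ := ⟨(ds.map put).reverse ++ [put D.bot], put d :: r⟩) h
    have e : (Tape.move .left ⟨((ds ++ [d]).map put).reverse ++ [put D.bot], r⟩ : Tape D.Γ) =
        ⟨(ds.map put).reverse ++ [put D.bot], put d :: r⟩ := by simp [Tape.move]
    rw [e]
    refine .of_step h' (ih (fun d hd => hds d (by simp [hd])) (put d :: r) (fun t₀ q => ?_) _ _)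
    simpa using H t₀ q

/-- The tape of the simulated tape decider. -/
def simTape {Γ : Type} [Inhabited Γ] (t : Tape Γ) : Turing.Tape Γ :=
  Turing.Tape.mk' (Turing.ListBlank.mk (t.left.map symVal))
    (Turing.ListBlank.mk (t.right.map symVal))

theorem head_simTape {Γ : Type} [Inhabited Γ] (t : Tape Γ) :
    (simTape t).head = symVal t.read := by
  obtain ⟨l, r⟩ := t
  cases r <;> simp [simTape, Tape.read, symVal]

theorem simTape_write {Γ : Type} [Inhabited Γ] (t : Tape Γ) (a : Symbol Γ) :
    simTape (t.write a) = (simTape t).write (symVal a) := by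
  simp [simTape, Tape.write, Turing.Tape.write_mk']

theorem simTape_move {Γ : Type} [Inhabited Γ] (t : Tape Γ) (d : Dir) :
    simTape (t.move (dirMove d)) = (simTape t).move d := by
  obtain ⟨l, r⟩ := t
  cases d
  · cases l <;> simp [simTape, Tape.move, dirMove, symVal]
  · cases r <;> simp [simTape, Tape.move, dirMove, symVal]

theorem simTape_write_read {Γ : Type} [Inhabited Γ] (t : Tape Γ) :
    simTape (t.write t.read) = simTape t := by
  rw [simTape_write, ← head_simTape, Turing.Tape.write_self]

/-- Each step of the decider is matched by one step of the machine. After the last one, moving right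
reaches the cell that holds the answer. -/
theorem halts_sim {c c' : TM0.Cfg D.Γ D.Λ}
    (h : c' ∈ StateTransition.eval (TM0.step D.M) c) (t₀ t₁ : Tape D.Γ) (q : List Bool)
    (ht : simTape t₁ = c.Tape) :
    (prefixMachine D).Halts O (prefixCfg D (.sim c.q) t₀ t₁ q)
      (D.ans (c'.Tape.move Dir.right).head) := by
  obtain ⟨hr, hn⟩ := StateTransition.mem_eval.1 h
  clear h
  induction hr using Relation.ReflTransGen.head_induction_on generalizing t₀ t₁ q with
  | refl =>
    have hM : D.M c'.q (symVal t₁.read) = none := by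
      rw [← head_simTape, ht]
      simpa [TM0.step] using hn
    have h : prefixTrans D (.sim c'.q) t₀.read t₁.read =
        .act .fin ![(t₀.read, .stay), (t₁.read, .right)] none := by
      simp [prefixTrans, hM]
    refine .of_step (step_act h) ⟨1, OracleTM.run_succ_of_halt (step_halt ?_) 0⟩
    rw [← ht, ← simTape_write_read t₁, ← simTape_move, head_simTape]
    rfl
  | @head c c₁ hstep _ ih =>
    obtain ⟨s, T⟩ := c
    simp only at ht
    subst ht
    simp only [TM0.step, Option.mem_def, Option.map_eq_some_iff] at hstep
    obtain ⟨⟨s', a⟩, hM, rfl⟩ := hstep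
    rw [head_simTape] at hM
    cases a with
    | move d =>
      have h : prefixTrans D (.sim s) t₀.read t₁.read =
          .act (.sim s') ![(t₀.read, .stay), (t₁.read, dirMove d)] none := by
        simp [prefixTrans, hM]
      refine .of_step (step_act h) (ih _ _ _ ?_)
      simp [simTape_move, simTape_write_read]
    | write g =>
      have h : prefixTrans D (.sim s) t₀.read t₁.read =
          .act (.sim s') ![(t₀.read, .stay), (put g, .stay)] none := by
        simp [prefixTrans, hM]
      refine .of_step (step_act h) (ih _ _ _ ?_)
      simp [Tape.move, simTape_write]

theorem run_init_of_scan (h : scan O [] x = true) :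
    (prefixMachine D).run O (2 * x.length + 3) ((prefixMachine D).init x) = some false := by
  rw [init_prefixMachine, OracleTM.run_succ_of_step step_bot, OracleTM.run_succ_of_step step_lead]
  -- For empty input, rewriting the scanned blank has turned the tape list `[]` into `[none]`, so
  -- the general lemma does not apply literally.
  cases x with
  | nil => exact OracleTM.run_succ_of_halt (step_halt rfl) _
  | cons c x => exact run_tag_of_scan h _ _

theorem halts_init_of_not_scan {g : List Bool → Bool} (hD : D.Computes g)
    (h : scan O [] x = false) :
    (prefixMachine D).Halts O ((prefixMachine D).init x) (g x) := by
  rw [init_prefixMachine]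
  refine .of_step step_bot (.of_step step_lead ?_)
  -- Rewriting the scanned symbol leaves a nonempty tape list unchanged; the empty input is excluded
  -- because its scan succeeds.
  have hx : ∃ l : Tape D.Γ, l.right = bits x ∧
      ((⟨[], bits x⟩ : Tape D.Γ).write (Tape.read ⟨[], bits x⟩)).write
        (Tape.read ((⟨[], bits x⟩ : Tape D.Γ).write (Tape.read ⟨[], bits x⟩))) = l := by
    refine ⟨_, ?_, rfl⟩
    cases x with
    | nil => simp [scan] at h
    | cons c x => rfl
  obtain ⟨⟨l, r⟩, hr, ht⟩ := hx
  simp only at hr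
  rw [ht, hr]
  refine halts_tag h fun t₀ q => ?_
  have := halts_rew (O := O) (b := g x) (ds := D.lead :: x.map D.enc) (by
    simp only [List.mem_cons, List.mem_map]
    rintro d (rfl | ⟨c, _, rfl⟩)
    · exact D.isBot_lead
    · exact D.isBot_enc c) [none] (fun t₀ q => ?_) t₀ q
  · simpa [Function.comp_def] using this
  · obtain ⟨c, hc, hans⟩ := hD x
    rw [← hans]
    refine halts_sim hc _ _ _ ?_
    simp only [simTape, TM0.init, Turing.Tape.mk₁, Turing.Tape.mk₂]
    congr 1
    -- The trailing blank left by the copying phase disappears modulo blanks.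
    refine (Quotient.sound' (Or.inl ⟨1, ?_⟩)).symm
    simp [Function.comp_def]

end

/-- If `g` is computable and rejects every list of correct claims about `A`, then some machine
with oracle `A` computes `g`, and it is fast on the lists of correct claims. -/
theorem exists_fast_machine {g : List Bool → Bool} (hg : Computable g) (A : ℕ → Bool)
    (hA : ∀ x, scan (toOracle A) [] x = true → g x = false) :
    ∃ (M : OracleTM) (f : List Bool → ℕ), M.DecidesInTime (toOracle A) {x | g x = true} f ∧
      ∀ x, scan (toOracle A) [] x = true → f x = 2 * x.length + 3 := by
  obtain ⟨D, hD⟩ := exists_tapeDecider hg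
  have hex : ∀ x, ∃ t, (prefixMachine D).run (toOracle A) t ((prefixMachine D).init x) =
      some (g x) ∧ (scan (toOracle A) [] x = true → t = 2 * x.length + 3) := by
    intro x
    cases hs : scan (toOracle A) [] x
    · obtain ⟨t, ht⟩ := halts_init_of_not_scan hD hs
      exact ⟨t, ht, by simp⟩
    · exact ⟨_, by rw [run_init_of_scan hs, hA x hs], fun _ => rfl⟩
  choose f hf hf' using hex
  exact ⟨prefixMachine D, f, fun x => ⟨g x, hf x, Iff.rfl⟩, hf'⟩

end LowForSpeed

namespace LowForSpeed

/-! ### The Schnorr test of a computable sequence of strings -/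

open MeasureTheory

theorem lebesgue_cylinder (τ : List Bool) : lebesgue (cylinder τ) = (1 / 2) ^ τ.length := by
  have h : cylinder τ = Set.pi (Finset.range τ.length : Finset ℕ) fun i => {τ.getD i false} := by
    ext A
    simp only [cylinder, Set.mem_ofPred_eq, Set.mem_pi, Finset.coe_range, Set.mem_Iio,
      Set.mem_singleton_iff]
    refine forall_congr' fun i => forall_congr' fun hi => ?_
    rw [List.getD_eq_getElem _ _ hi]
  rw [h, lebesgue, Measure.infinitePi_pi _ fun _ _ => measurableSet_singleton _]
  simp

instance : IsProbabilityMeasure lebesgue := by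
  unfold lebesgue
  infer_instance

theorem measurableSet_cylinder (τ : List Bool) : MeasurableSet (cylinder τ) := by
  have h : cylinder τ = ⋂ (i : ℕ) (hi : i < τ.length), (fun A : ℕ → Bool => A i) ⁻¹' {τ[i]} := by
    ext A
    simp [cylinder]
  rw [h]
  exact MeasurableSet.iInter fun i => MeasurableSet.iInter fun _ =>
    measurable_pi_apply i (measurableSet_singleton _)

/-! ### Tails of a sequence of cylinders and the computation of their measures -/

section
variable (σ : ℕ → List Bool)

/-- The sequences that extend some `σ n` with `k < n`. -/
def prefixTail (k : ℕ) : Set (ℕ → Bool) := {A | ∃ n, k < n ∧ A ∈ cylinder (σ n)}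

/-- The sequences that extend some `σ n` with `k < n ≤ j`. -/
def prefixRange (k j : ℕ) : Set (ℕ → Bool) := {A | ∃ n, k < n ∧ n ≤ j ∧ A ∈ cylinder (σ n)}

/-- Bounded search. -/
def existsLt (p : ℕ → Bool) (n : ℕ) : Bool := Nat.rec false (fun m ih => ih || p m) n

theorem existsLt_eq_true {p : ℕ → Bool} {n : ℕ} :
    existsLt p n = true ↔ ∃ m < n, p m = true := by
  induction n with
  | zero => simp [existsLt]
  | succ n ih =>
    have : existsLt p (n + 1) = (existsLt p n || p n) := rfl
    rw [this, Bool.or_eq_true, ih]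
    simp only [Nat.lt_succ_iff_lt_or_eq, or_and_right, exists_or, exists_eq_left]

theorem computable_existsLt {α : Type*} [Primcodable α] {p : α → ℕ → Bool} {b : α → ℕ}
    (hp : Computable₂ p) (hb : Computable b) : Computable fun a => existsLt (p a) (b a) :=
  Computable.nat_rec hb (Computable.const false) (Primrec.or.to_comp.comp
    (Computable.snd.comp Computable.snd)
    (hp.comp Computable.fst (Computable.fst.comp Computable.snd))).to₂

/-- Whether `k < n` and none of the strings `σ m` with `k < m < n` is a prefix of `σ n`. -/
def isMinimal (k n : ℕ) : Bool :=
  decide (k < n) && !existsLt (fun m => decide (k < m) && decide ((σ n).take m = σ m)) n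

/-- The measure of `prefixRange σ k j`, multiplied by `2 ^ j`. -/
def rangeCount (k j : ℕ) : ℕ :=
  -- Doubling passes to the unit `2⁻⁽ʲ⁺¹⁾`, the measure of the next cylinder, which counts only if
  -- it is not already covered.
  Nat.rec 0 (fun j ih => 2 * ih + (isMinimal σ k (j + 1)).toNat) j

variable {σ}

theorem computable_isMinimal (hσ : Computable σ) : Computable₂ (isMinimal σ) := by
  have hlt : Computable₂ fun a b : ℕ => decide (a < b) := Primrec.nat_lt.decide.to_comp
  have heq : Computable₂ fun a b : List Bool => decide (a = b) := Primrec.eq.decide.to_comp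
  have hbody : Computable₂ fun (p : ℕ × ℕ) (m : ℕ) =>
      decide (p.1 < m) && decide ((σ p.2).take m = σ m) := by
    refine Primrec.and.to_comp.comp ?_ ?_
    · exact hlt.comp (Computable.fst.comp Computable.fst) Computable.snd
    · exact heq.comp (Primrec.list_take.to_comp.comp Computable.snd
        (hσ.comp (Computable.snd.comp Computable.fst))) (hσ.comp Computable.snd)
  exact Primrec.and.to_comp.comp hlt (Primrec.not.to_comp.comp
    (computable_existsLt hbody Computable.snd))

theorem computable_rangeCount (hσ : Computable σ) : Computable₂ (rangeCount σ) := by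
  refine Computable.nat_rec (h := fun (p : ℕ × ℕ) q =>
    2 * q.2 + (isMinimal σ p.1 (q.1 + 1)).toNat) Computable.snd (Computable.const 0) ?_
  exact Primrec.nat_add.to_comp.comp (Primrec.nat_mul.to_comp.comp (Computable.const 2)
    (Computable.snd.comp Computable.snd)) ((Primrec.dom_finite Bool.toNat).to_comp.comp
    ((computable_isMinimal hσ).comp (Computable.fst.comp Computable.fst)
      (Computable.succ.comp (Computable.fst.comp Computable.snd))))

theorem prefixRange_eq_empty {k j : ℕ} (h : j ≤ k) : prefixRange σ k j = ∅ := by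
  ext A
  simp only [prefixRange, Set.mem_ofPred_eq, Set.mem_empty_iff_false, iff_false]
  rintro ⟨n, h1, h2, -⟩
  omega

theorem take_eq_of_mem_cylinder {A : ℕ → Bool} {τ ρ : List Bool} (hτ : A ∈ cylinder τ)
    (hρ : A ∈ cylinder ρ) (h : ρ.length ≤ τ.length) : τ.take ρ.length = ρ := by
  refine List.ext_getElem (by simp [h]) fun i h1 h2 => ?_
  rw [List.getElem_take, ← hτ i (by omega), ← hρ i h2]

theorem mem_cylinder_take {A : ℕ → Bool} {τ : List Bool} (hτ : A ∈ cylinder τ) (n : ℕ) :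
    A ∈ cylinder (τ.take n) := by
  intro i hi
  rw [List.getElem_take]
  exact hτ i _

/-- A string that is not minimal either has too small an index or extends an earlier string, whose
cylinder contains its own. -/
theorem prefixRange_succ_of_not_isMinimal {k j : ℕ} (h : isMinimal σ k (j + 1) = false) :
    prefixRange σ k (j + 1) = prefixRange σ k j := by
  ext A
  constructor
  · rintro ⟨n, hkn, hnj, hA⟩
    obtain hnj | rfl := Nat.le_succ_iff.1 hnj
    · exact ⟨n, hkn, hnj, hA⟩
    · rw [isMinimal, decide_eq_true hkn, Bool.true_and, Bool.not_eq_false', existsLt_eq_true] at h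
      simp only [Bool.and_eq_true, decide_eq_true_eq] at h
      obtain ⟨m, hm, hkm, e⟩ := h
      exact ⟨m, hkm, by omega, e ▸ mem_cylinder_take hA m⟩
  · rintro ⟨n, hkn, hnj, hA⟩
    exact ⟨n, hkn, by omega, hA⟩

variable (hl : ∀ n, (σ n).length = n)
include hl

/-- Cylinders are nested or disjoint. Minimality rules out nesting in an earlier one, so the
measures add. -/
theorem lebesgue_prefixRange_succ_of_isMinimal {k j : ℕ} (h : isMinimal σ k (j + 1) = true) :
    lebesgue (prefixRange σ k (j + 1)) = lebesgue (prefixRange σ k j) + (1 / 2) ^ (j + 1) := by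
  simp only [isMinimal, Bool.and_eq_true, decide_eq_true_eq, Bool.not_eq_true',
    ← Bool.not_eq_true, existsLt_eq_true] at h
  obtain ⟨hk, h⟩ := h
  have hu : prefixRange σ k (j + 1) = prefixRange σ k j ∪ cylinder (σ (j + 1)) := by
    ext A
    constructor
    · rintro ⟨n, hkn, hnj, hA⟩
      obtain hnj | rfl := Nat.le_succ_iff.1 hnj
      · exact Or.inl ⟨n, hkn, hnj, hA⟩
      · exact Or.inr hA
    · rintro (⟨n, hkn, hnj, hA⟩ | hA)
      · exact ⟨n, hkn, by omega, hA⟩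
      · exact ⟨j + 1, hk, le_rfl, hA⟩
  have hd : Disjoint (prefixRange σ k j) (cylinder (σ (j + 1))) := by
    rw [Set.disjoint_left]
    rintro A ⟨n, hkn, hnj, hA⟩ hA'
    refine h ⟨n, by omega, hkn, ?_⟩
    have := take_eq_of_mem_cylinder hA' hA (by rw [hl, hl]; omega)
    rwa [hl] at this
  rw [hu, measure_union hd (measurableSet_cylinder _), lebesgue_cylinder, hl]

theorem toReal_lebesgue_prefixRange (k j : ℕ) :
    (lebesgue (prefixRange σ k j)).toReal = (rangeCount σ k j : ℝ) / 2 ^ j := by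
  induction j with
  | zero => simp [prefixRange_eq_empty (Nat.zero_le k), rangeCount]
  | succ j ih =>
    have hc : rangeCount σ k (j + 1) =
        2 * rangeCount σ k j + (isMinimal σ k (j + 1)).toNat := rfl
    cases h : isMinimal σ k (j + 1)
    · rw [prefixRange_succ_of_not_isMinimal h, ih, hc, h]
      push_cast [Bool.toNat_false]
      field_simp
      ring
    · have hp : ((1 / 2 : ENNReal) ^ (j + 1)).toReal = 1 / 2 ^ (j + 1) := by simp
      rw [lebesgue_prefixRange_succ_of_isMinimal hl h, ENNReal.toReal_add (measure_ne_top _ _)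
        (by simp), hp, ih, hc, h]
      push_cast [Bool.toNat_true]
      field_simp
      ring

/-- The cylinders with index above `j` have total measure at most the geometric tail `2⁻ʲ`. This
error bound makes the measure computable. -/
theorem lebesgue_prefixTail_le_add (k j : ℕ) :
    lebesgue (prefixTail σ k) ≤ lebesgue (prefixRange σ k j) + (1 / 2) ^ j := by
  have h : prefixTail σ k ⊆ prefixRange σ k j ∪ ⋃ i : ℕ, cylinder (σ (j + 1 + i)) := by
    rintro A ⟨n, hn, hA⟩
    by_cases hj : n ≤ j
    · exact Or.inl ⟨n, hn, hj, hA⟩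
    · refine Or.inr (Set.mem_iUnion.2 ⟨n - (j + 1), ?_⟩)
      rwa [show j + 1 + (n - (j + 1)) = n by omega]
  refine (measure_mono h).trans ((measure_union_le _ _).trans ?_)
  gcongr
  refine (measure_iUnion_le _).trans ?_
  simp only [lebesgue_cylinder, hl, pow_add _ (j + 1), ENNReal.tsum_mul_left,
    ENNReal.tsum_geometric]
  rw [pow_succ, mul_assoc, one_div, ENNReal.one_sub_inv_two, inv_inv,
    ENNReal.inv_mul_cancel (by simp) (by simp), mul_one]

theorem lebesgue_prefixTail_le (k : ℕ) : lebesgue (prefixTail σ k) ≤ (1 / 2) ^ k := by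
  simpa [prefixRange_eq_empty le_rfl] using lebesgue_prefixTail_le_add hl k k

theorem isSchnorrTest_prefixTail (hσ : Computable σ) : IsSchnorrTest (prefixTail σ) where
  effectivelyOpen := by
    -- The length of a string reveals which member of the sequence it could be, so the enumerating
    -- set is even decidable.
    refine ⟨{p | p.1 < p.2.length ∧ p.2 = σ p.2.length}, ?_, fun k => ?_⟩
    · have h : Computable fun p : ℕ × List Bool =>
          decide (p.1 < p.2.length) && decide (p.2 = σ p.2.length) := by
        have hlen : Computable fun p : ℕ × List Bool => p.2.length :=
          Computable.list_length.comp Computable.snd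
        exact Primrec.and.to_comp.comp (Primrec.nat_lt.decide.to_comp.comp Computable.fst hlen)
          (Primrec.eq.decide.to_comp.comp Computable.snd (hσ.comp hlen))
      refine (ComputablePred.computable_iff.2 ⟨_, h, ?_⟩).to_re
      funext p
      simp
    · ext A
      simp only [prefixTail, Set.mem_ofPred_eq, Set.mem_iUnion, exists_prop]
      constructor
      · rintro ⟨n, hn, hA⟩
        exact ⟨σ n, ⟨by rwa [hl], by rw [hl]⟩, hA⟩
      · rintro ⟨τ, ⟨hk, e⟩, hA⟩
        exact ⟨τ.length, hk, e ▸ hA⟩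
  measure_le := lebesgue_prefixTail_le hl
  computable_measure := by
    refine ⟨fun p => rangeCount σ p.1 p.2, computable_rangeCount hσ, fun k j => ?_⟩
    rw [← toReal_lebesgue_prefixRange hl]
    have h1 : (lebesgue (prefixRange σ k j)).toReal ≤ (lebesgue (prefixTail σ k)).toReal :=
      ENNReal.toReal_mono (measure_ne_top _ _)
        (measure_mono fun A ⟨n, h, _, hA⟩ => ⟨n, h, hA⟩)
    have h2 : (lebesgue (prefixTail σ k)).toReal ≤
        (lebesgue (prefixRange σ k j)).toReal + 1 / 2 ^ j := by
      refine (ENNReal.toReal_mono (by finiteness) (lebesgue_prefixTail_le_add hl k j)).trans ?_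
      rw [ENNReal.toReal_add (measure_ne_top _ _) (by simp)]
      simp
    rw [abs_of_nonneg (by linarith)]
    linarith

end

end LowForSpeed

namespace LowForSpeed

/-! ### Random sequences are not low for speed -/

/-- The strings of length `n`. -/
def strings (n : ℕ) : List (List Bool) :=
  Nat.rec [[]] (fun _ ih => ih.flatMap fun l => [false :: l, true :: l]) n

theorem mem_strings {n : ℕ} {l : List Bool} : l ∈ strings n ↔ l.length = n := by
  induction n generalizing l with
  | zero => simp [strings]
  | succ n ih =>
    have : strings (n + 1) = (strings n).flatMap fun l => [false :: l, true :: l] := rfl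
    rw [this, List.mem_flatMap]
    constructor
    · rintro ⟨l', hl', h⟩
      rw [ih] at hl'
      simp only [List.mem_cons, List.not_mem_nil, or_false] at h
      obtain rfl | rfl := h <;> simp [hl']
    · intro h
      cases l with
      | nil => simp at h
      | cons b l =>
        refine ⟨l, ih.2 (by simpa using h), ?_⟩
        cases b <;> simp

theorem primrec_strings : Primrec strings := by
  refine Primrec.nat_rec₁ _ (Primrec.list_flatMap Primrec.snd ?_)
  exact Primrec.list_cons.comp (Primrec.list_cons.comp (Primrec.const false) Primrec.snd)
    (Primrec.list_cons.comp (Primrec.list_cons.comp (Primrec.const true) Primrec.snd)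
      (Primrec.const []))

/-- A superpolynomial time bound for the inputs `prefixCode b`, in which `b` has length `n`. -/
def timeBound (n : ℕ) (b : List Bool) : ℕ := (2 * (prefixCode b).length + 3) ^ n

theorem primrec_timeBound : Primrec₂ timeBound := by
  refine (Primrec₂.unpaired'.1 Nat.Primrec.pow).comp (Primrec.nat_add.comp (Primrec.nat_mul.comp (Primrec.const 2)
    (Primrec.list_length.comp (primrec_prefixCode.comp Primrec.snd))) (Primrec.const 3))
    Primrec.fst

/-- A string of length `n` whose code is quickly rejected by the machine `M`, if there is one. -/
def rejected (M : OracleTM) (n : ℕ) : List Bool :=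
  (((strings n).filterMap fun b => if M.run (fun _ => false) (timeBound n b)
    (M.init (prefixCode b)) = some false then some b else none).head?).getD
      (List.replicate n false)

/-- The search is over finitely many strings with a primitive recursive time bound; this puts the
sequence within reach of `target`. -/
theorem primrec_rejected {M : OracleTM} (hM : M.OracleFree) : Primrec (rejected M) := by
  refine Primrec.option_getD.comp (Primrec.list_head?.comp
    (Primrec.listFilterMap primrec_strings (Primrec.ite (Primrec.eq.comp
      ((OracleTM.primrec_run hM _).comp primrec_timeBound (primrec_prefixCode.comp Primrec.snd))
      (Primrec.const (some false))) (Primrec.option_some.comp Primrec.snd)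
      (Primrec.const none)))) ?_
  refine (Primrec.list_map Primrec.list_range (Primrec.const false).to₂).of_eq fun n => ?_
  simp

theorem length_rejected (M : OracleTM) (n : ℕ) : (rejected M n).length = n := by
  unfold rejected
  cases h : (List.filterMap _ (strings n)).head? with
  | none => simp
  | some b =>
    obtain ⟨b', hb', hb⟩ := List.mem_filterMap.1 (List.mem_of_mem_head? h)
    split_ifs at hb
    cases hb
    simpa [mem_strings] using hb'

theorem run_rejected {M : OracleTM} {b : List Bool}
    (hb : M.run (fun _ => false) (timeBound b.length b) (M.init (prefixCode b)) = some false) :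
    M.run (fun _ => false) (timeBound b.length (rejected M b.length))
      (M.init (prefixCode (rejected M b.length))) = some false := by
  have hmem : b ∈ (strings b.length).filterMap fun b' =>
      if M.run (fun _ => false) (timeBound b.length b') (M.init (prefixCode b')) = some false
      then some b' else none :=
    List.mem_filterMap.2 ⟨b, mem_strings.2 rfl, if_pos hb⟩
  unfold rejected
  cases h : (List.filterMap _ (strings b.length)).head? with
  | none =>
    rw [List.head?_eq_none_iff] at h
    rw [h] at hmem
    simp at hmem
  | some c =>
    obtain ⟨c', -, hc⟩ := List.mem_filterMap.1 (List.mem_of_mem_head? h)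
    split_ifs at hc with hc'
    cases hc
    exact hc'

/-- Letting the exponent grow with `n` makes one time bound serve for all polynomials. -/
theorem exists_eval_le_pow (p : Polynomial ℕ) :
    ∃ d, ∀ n ≥ d, ∀ N ≥ 2, p.eval N ≤ N ^ n := by
  induction p using Polynomial.induction_on' with
  | add p q hp hq =>
    obtain ⟨d, hd⟩ := hp
    obtain ⟨e, he⟩ := hq
    -- The additional factor `N ≥ 2` absorbs the sum of two powers.
    refine ⟨max d e + 1, fun n hn N hN => ?_⟩
    obtain ⟨n, rfl⟩ := Nat.exists_eq_succ_of_ne_zero (show n ≠ 0 by omega)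
    have h1 := hd n (by omega) N hN
    have h2 := he n (by omega) N hN
    rw [Polynomial.eval_add, pow_succ]
    nlinarith
  | monomial k a =>
    refine ⟨a + k, fun n hn N hN => ?_⟩
    rw [Polynomial.eval_monomial]
    calc a * N ^ k ≤ N ^ a * N ^ k := by
          gcongr
          exact (Nat.lt_pow_self (by omega)).le
      _ = N ^ (a + k) := (pow_add _ _ _).symm
      _ ≤ N ^ n := Nat.pow_le_pow_right (by omega) hn

/-- The characteristic function of the set of all `prefixCode (target n)` with `k < n`. -/
def targetLanguage (k : ℕ) (x : List Bool) : Bool :=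
  existsLt (fun n => decide (k < n) && decide (x = prefixCode (target n))) (x.length + 1)

theorem targetLanguage_eq_true {k : ℕ} {x : List Bool} :
    targetLanguage k x = true ↔ ∃ n, k < n ∧ x = prefixCode (target n) := by
  simp only [targetLanguage, existsLt_eq_true, Bool.and_eq_true, decide_eq_true_eq]
  constructor
  · rintro ⟨n, -, h⟩
    exact ⟨n, h⟩
  · rintro ⟨n, hn, rfl⟩
    refine ⟨n, Nat.lt_succ_of_le ?_, hn, rfl⟩
    simpa [length_target] using length_le_length_prefixCode (target n)

theorem computable_targetLanguage (k : ℕ) : Computable (targetLanguage k) := by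
  refine computable_existsLt (Primrec.and.to_comp.comp ?_ ?_)
    (Computable.succ.comp Computable.list_length)
  · exact Primrec.nat_lt.decide.to_comp.comp (Computable.const k) Computable.snd
  · exact Primrec.eq.decide.to_comp.comp Computable.fst
      (primrec_prefixCode.to_comp.comp (computable_target.comp Computable.snd))

theorem not_isLowForSpeed {A : ℕ → Bool} {k : ℕ} (hA : A ∉ prefixTail target k) :
    ¬ IsLowForSpeed A := by
  intro hlow
  obtain ⟨M, f, hM, hf⟩ := exists_fast_machine (computable_targetLanguage k) A (by
    intro x hx
    rw [← Bool.not_eq_true, targetLanguage_eq_true]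
    rintro ⟨n, hn, rfl⟩
    exact hA ⟨n, hn, (scan_prefixCode A _).1 hx⟩)
  obtain ⟨M', p, hfree, hM'⟩ := hlow {x | targetLanguage k x = true}
    (ComputablePred.computable_iff.2 ⟨_, computable_targetLanguage k, rfl⟩) M f hM
  obtain ⟨d, hd⟩ := exists_eval_le_pow p
  -- The index is beyond `d`, so that the time bound dominates `p`, and beyond `k`, so that the code
  -- of `target n` is in the language.
  obtain ⟨n, hn, hrej⟩ := frequently_target_eq (primrec_rejected hfree) (length_rejected M')
    (max d (k + 1))
  have hb : ((List.range n).map A).length = n := by simp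
  have hbA := mem_cylinder_map_range A n
  generalize (List.range n).map A = b at hb hbA
  subst hb
  have hscan := (scan_prefixCode A b).2 hbA
  -- The prefix of `A` of length `n` witnesses that the search succeeds; accepting its code would
  -- put `A` into the avoided test set.
  have hreject : M'.run (fun _ => false) (timeBound b.length b) (M'.init (prefixCode b)) =
      some false := by
    obtain ⟨c, hrun, hc⟩ := hM' (prefixCode b)
    cases c
    · refine OracleTM.run_mono ?_ hrun
      beta_reduce
      rw [hf _ hscan]
      exact hd _ (by omega) _ (by omega)
    · obtain ⟨m, hm, e⟩ := targetLanguage_eq_true.1 (hc.1 rfl)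
      exact absurd ⟨m, hm, (scan_prefixCode A _).1 (e ▸ hscan)⟩ hA
  have hwrong := run_rejected hreject
  rw [← hrej] at hwrong
  obtain ⟨c, hrun, hc⟩ := hM' (prefixCode (target b.length))
  have hmem : prefixCode (target b.length) ∈ {x | targetLanguage k x = true} :=
    targetLanguage_eq_true.2 ⟨b.length, by omega, rfl⟩
  rw [hc.2 hmem] at hrun
  -- On this input `f` is not controlled, so the accepting run may be long or short; either way, the
  -- shorter run fixes the answer of the longer one.
  obtain h | h := le_total (p.eval (f (prefixCode (target b.length))))
    (timeBound b.length (target b.length))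
  · simpa [hwrong] using OracleTM.run_mono h hrun
  · simpa [hrun] using OracleTM.run_mono h hwrong

end LowForSpeed

theorem mainTheorem1 :
    LowForSpeed.lebesgue LowForSpeed.LFS = 0 ∧
      ∀ A : ℕ → Bool, LowForSpeed.IsSchnorrRandom A → ¬ LowForSpeed.IsLowForSpeed A := by
  have htest := LowForSpeed.isSchnorrTest_prefixTail LowForSpeed.length_target
    LowForSpeed.computable_target
  have hsub : LowForSpeed.LFS ⊆ ⋂ k, LowForSpeed.prefixTail LowForSpeed.target k := by
    intro A hA
    refine Set.mem_iInter.2 fun k => ?_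
    by_contra hk
    exact LowForSpeed.not_isLowForSpeed hk hA
  -- Monotonicity of the outer measure suffices, so measurability of the class is not needed.
  refine ⟨le_antisymm (ge_of_tendsto' (ENNReal.tendsto_pow_atTop_nhds_zero_of_lt_one
    (r := 1 / 2) (by simp)) fun k => ?_) bot_le, fun A hA hlow => hA _ htest (hsub hlow)⟩
  exact (MeasureTheory.measure_mono (hsub.trans (Set.iInter_subset _ k))).trans
    (htest.measure_le k)
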